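/- Let $p\in\mathbb N$, let $\mathbf X$ be a random vector in $\mathbb R^p$ and $\varepsilon$ a real random variable on a common probability space, let $f\colon\mathbb R^p\to\mathbb R$ be measurable, and let $0\le\sigma<\sigma'$. Put $Y=f(\mathbf X)+\sigma\varepsilon$ and $Y'=f(\mathbf X)+\sigma'\varepsilon$. Assume that $\varepsilon$ is independent of $f(\mathbf X)$ and, in case $\sigma>0$, also of $\mathbf X$ itself. Assume further that the distribution functions $F_Y$ and $F_{Y'}$ are continuous. Then $(Y',\mathbf X)\preccurlyeq_{ccx}(Y,\mathbf X)$ in the conditional convex order, that is, for all $v\in(0,1)$ and all convex functions $\varphi\colon\mathbb R\to\mathbb R$, $$\mathbb E\,\varphi\big(P(Y'\ge q_{Y'}(v)\mid\mathbf X)\big)\ \le\ \mathbb E\,\varphi\big(P(Y\ge q_Y(v)\mid\mathbf X)\big),$$ where $q_W(v):=\inf\{w\in\mathbb R: F_W(w)\ge v\}$ denotes the left-continuous quantile function of a random variable $W$ with distribution function $F_W$. (Both expectations exist, since the conditional probabilities are $[0,1]$-valued.) -/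

import Mathlib

open MeasureTheory ProbabilityTheory

noncomputable section

/-- The distribution function `F_Y` of a real random variable `Y` under `P`. -/
def distFun {Ω : Type*} [MeasurableSpace Ω] (P : Measure Ω) (Y : Ω → ℝ) : ℝ → ℝ :=
  fun y => P.real {ω | Y ω ≤ y}

/-- The left-continuous quantile function `q_Y(v) = inf {y | F_Y(y) ≥ v}`; it is used only for
`v ∈ (0,1)`, where the set is nonempty and bounded below. -/
def quantile {Ω : Type*} [MeasurableSpace Ω] (P : Measure Ω) (Y : Ω → ℝ) (v : ℝ) : ℝ :=
  sInf {y : ℝ | v ≤ distFun P Y y}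

/-- The conditional survival probability `P(Y ≥ y | X)`, as a random variable: the conditional
expectation of the indicator of `{Y ≥ y}` given the σ-algebra generated by `X`. -/
def condSurvival {Ω : Type*} [MeasurableSpace Ω] (P : Measure Ω) {p : ℕ}
    (Y : Ω → ℝ) (X : Ω → Fin p → ℝ) (y : ℝ) : Ω → ℝ :=
  P[Set.indicator {ω | y ≤ Y ω} (fun _ => (1 : ℝ)) |
    MeasurableSpace.comap X (inferInstance : MeasurableSpace (Fin p → ℝ))]

/-- The convex order `S ≤_cx T` between (essentially) bounded random variables, possibly on
different probability spaces: `E φ(S) ≤ E φ(T)` for all convex `φ : ℝ → ℝ`. For bounded random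
variables the two expectations exist automatically; their existence is included so that the
inequality is never one between default values. -/
def ConvexOrderLE {Ω Ω' : Type*} [MeasurableSpace Ω] [MeasurableSpace Ω']
    (P : Measure Ω) (S : Ω → ℝ) (P' : Measure Ω') (T : Ω' → ℝ) : Prop :=
  ∀ φ : ℝ → ℝ, ConvexOn ℝ Set.univ φ →
    Integrable (fun ω => φ (S ω)) P ∧ Integrable (fun ω => φ (T ω)) P' ∧
      ∫ ω, φ (S ω) ∂P ≤ ∫ ω, φ (T ω) ∂P'

/-- The conditional convex order `(Y, X) ≼_ccx (Y', X')`: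
`P(Y ≥ q_Y(v) | X) ≤_cx P(Y' ≥ q_{Y'}(v) | X')` for all `v ∈ (0,1)`. -/
def CondConvexLE {Ω Ω' : Type*} [MeasurableSpace Ω] [MeasurableSpace Ω'] {p p' : ℕ}
    (P : Measure Ω) (Y : Ω → ℝ) (X : Ω → Fin p → ℝ)
    (P' : Measure Ω') (Y' : Ω' → ℝ) (X' : Ω' → Fin p' → ℝ) : Prop :=
  ∀ v ∈ Set.Ioo (0 : ℝ) 1,
    ConvexOrderLE P (condSurvival P Y X (quantile P Y v))
      P' (condSurvival P' Y' X' (quantile P' Y' v))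

end

open Set Filter Topology

/-! Continuity of the distribution functions gives both conditional survival probabilities the mean
`1 - v`. For `σ > 0`, independence writes them as `G((q - f(X))/σ)` and `G((q' - f(X))/σ')` with
`G(s) = P(ε ≥ s)` decreasing. The two arguments are affine in `f(X)` and cross once, at a level `t`,
so the first variable always lies beyond the second as seen from `G(t)`; with equal means,
`convexOrderLE_of_crossing` applies. For `σ = 0` the first variable is an indicator, the extreme
case of `convexOrderLE_indicator`. -/

/-- If `b` lies further away from `c` than `a` does, on the same side, then a convex function
satisfies the subgradient inequality at `c` for its increment from `a` to `b`. -/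
theorem ConvexOn.rightDeriv_mul_sub_le_sub {φ : ℝ → ℝ} (hφ : ConvexOn ℝ univ φ) {a b c : ℝ}
    (h : (c ≤ a ∧ a ≤ b) ∨ (b ≤ a ∧ a ≤ c)) :
    derivWithin φ (Ioi c) c * (b - a) ≤ φ b - φ a := by
  have hmem : ∀ x : ℝ, x ∈ interior (univ : Set ℝ) := by simp
  rcases h with ⟨hca, hab⟩ | ⟨hba, hac⟩
  · rcases hab.eq_or_lt with rfl | hab
    · simp
    have h1 := hφ.rightDeriv_le_slope_of_mem_interior (hmem a) (mem_univ b) hab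
    have h2 := hφ.monotoneOn_rightDeriv (hmem c) (hmem a) hca
    have h3 := h2.trans h1
    rw [slope_def_field, le_div_iff₀ (sub_pos.2 hab)] at h3
    exact h3
  · rcases hba.eq_or_lt with rfl | hba
    · simp
    have h1 := hφ.slope_le_leftDeriv_of_mem_interior (mem_univ b) (hmem a) hba
    have h2 := hφ.monotoneOn_leftDeriv (hmem a) (hmem c) hac
    have h3 := (h1.trans h2).trans (hφ.leftDeriv_le_rightDeriv_of_mem_interior (hmem c))
    rw [slope_def_field, div_le_iff₀ (sub_pos.2 hba)] at h3
    linarith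

theorem ConvexOn.integrable_comp_of_mem_Icc {Ω : Type*} [MeasurableSpace Ω] {P : Measure Ω}
    [IsFiniteMeasure P] {φ : ℝ → ℝ} (hφ : ConvexOn ℝ univ φ) {S : Ω → ℝ} {a b : ℝ}
    (hS : AEStronglyMeasurable S P) (hab : ∀ᵐ ω ∂P, S ω ∈ Icc a b) :
    Integrable (fun ω => φ (S ω)) P := by
  have hc : Continuous φ := continuousOn_univ.1 (hφ.continuousOn isOpen_univ)
  obtain ⟨C, hC⟩ := (isCompact_Icc (a := a) (b := b)).exists_bound_of_continuousOn hc.continuousOn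
  exact Integrable.of_bound (hc.comp_aestronglyMeasurable hS) C (hab.mono fun ω h => hC _ h)

/-- The single-crossing (cut) criterion for the convex order. -/
theorem convexOrderLE_of_crossing {Ω : Type*} [MeasurableSpace Ω] {P : Measure Ω}
    [IsFiniteMeasure P] {S T : Ω → ℝ} {a b c : ℝ} (hS : AEStronglyMeasurable S P)
    (hT : AEStronglyMeasurable T P) (hSab : ∀ᵐ ω ∂P, S ω ∈ Icc a b)
    (hTab : ∀ᵐ ω ∂P, T ω ∈ Icc a b) (hmean : ∫ ω, S ω ∂P = ∫ ω, T ω ∂P)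
    (hcross : ∀ᵐ ω ∂P, (c ≤ S ω ∧ S ω ≤ T ω) ∨ (T ω ≤ S ω ∧ S ω ≤ c)) :
    ConvexOrderLE P S P T := by
  intro φ hφ
  have iS := hφ.integrable_comp_of_mem_Icc hS hSab
  have iT := hφ.integrable_comp_of_mem_Icc hT hTab
  refine ⟨iS, iT, ?_⟩
  have jS : Integrable S P := (convexOn_id convex_univ).integrable_comp_of_mem_Icc hS hSab
  have jT : Integrable T P := (convexOn_id convex_univ).integrable_comp_of_mem_Icc hT hTab
  -- The slope at `c` does not depend on `ω`, so equality of means makes the lower bound integrate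
  -- to zero.
  have h := integral_mono_ae ((jT.sub jS).const_mul (derivWithin φ (Ioi c) c)) (iT.sub iS)
    (hcross.mono fun ω h => hφ.rightDeriv_mul_sub_le_sub h)
  simp only [Pi.sub_apply] at h
  rw [integral_const_mul, integral_sub jT jS, integral_sub iT iS, hmean] at h
  linarith

/-- Among random variables with values in `[0,1]` and a given mean, an indicator is the largest in
the convex order. -/
theorem convexOrderLE_indicator {Ω : Type*} [MeasurableSpace Ω] {P : Measure Ω}
    [IsProbabilityMeasure P] {S : Ω → ℝ} {A : Set Ω} (hS : AEStronglyMeasurable S P)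
    (hA : MeasurableSet A) (hS01 : ∀ᵐ ω ∂P, S ω ∈ Icc (0 : ℝ) 1)
    (hmean : ∫ ω, S ω ∂P = P.real A) :
    ConvexOrderLE P S P (A.indicator fun _ => (1 : ℝ)) := by
  intro φ hφ
  have jS : Integrable S P := (convexOn_id convex_univ).integrable_comp_of_mem_Icc hS hS01
  have iS := hφ.integrable_comp_of_mem_Icc hS hS01
  have jA : Integrable (A.indicator fun _ => (1 : ℝ)) P := (integrable_const 1).indicator hA
  -- On `{0, 1}` the function `φ` agrees with its chord, while on `[0, 1]` it lies below it; the
  -- integral of the chord depends only on the mean.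
  have hT : (fun ω => φ (A.indicator (fun _ => (1 : ℝ)) ω)) =
      fun ω => φ 0 + A.indicator (fun _ => (1 : ℝ)) ω * (φ 1 - φ 0) := by
    ext ω
    by_cases h : ω ∈ A <;> simp [h]
  have iT := (integrable_const (μ := P) (φ 0)).add (jA.mul_const (φ 1 - φ 0))
  refine ⟨iS, hT ▸ iT, ?_⟩
  have h := integral_mono_ae iS
    ((integrable_const (μ := P) (φ 0)).add (jS.mul_const (φ 1 - φ 0))) (hS01.mono fun ω h => by
      have := hφ.2 (mem_univ 0) (mem_univ 1) (sub_nonneg.2 h.2) h.1 (by ring)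
      simp only [smul_eq_mul, mul_zero, mul_one, zero_add] at this
      simp only [Pi.add_apply]
      linarith)
  refine h.trans (le_of_eq ?_)
  rw [hT]
  simp only [Pi.add_apply]
  rw [integral_add (integrable_const _) (jS.mul_const _),
    integral_add (integrable_const _) (jA.mul_const _), integral_mul_const, integral_mul_const,
    hmean, integral_indicator_const _ hA]
  simp

theorem distFun_eq_cdf {Ω : Type*} [MeasurableSpace Ω] (P : Measure Ω) [IsProbabilityMeasure P]
    {Y : Ω → ℝ} (hY : Measurable Y) : distFun P Y = cdf (P.map Y) := by
  have := Measure.isProbabilityMeasure_map (μ := P) hY.aemeasurable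
  ext y
  rw [cdf_eq_real, map_measureReal_apply hY measurableSet_Iic]
  rfl

theorem distFun_quantile {Ω : Type*} [MeasurableSpace Ω] (P : Measure Ω) [IsProbabilityMeasure P]
    {Y : Ω → ℝ} (hY : Measurable Y) (hF : Continuous (distFun P Y)) {v : ℝ}
    (hv : v ∈ Ioo (0 : ℝ) 1) : distFun P Y (quantile P Y v) = v := by
  have hcdf := distFun_eq_cdf P hY
  have hmono : Monotone (distFun P Y) := hcdf ▸ monotone_cdf _
  have hbot : Tendsto (distFun P Y) atBot (𝓝 0) := hcdf ▸ tendsto_cdf_atBot _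
  have htop : Tendsto (distFun P Y) atTop (𝓝 1) := hcdf ▸ tendsto_cdf_atTop _
  obtain ⟨a, ha⟩ := (hbot.eventually (gt_mem_nhds hv.1)).exists
  obtain ⟨b, hb⟩ := (htop.eventually (lt_mem_nhds hv.2)).exists
  obtain ⟨y, hy⟩ := mem_range_of_exists_le_of_exists_ge hF ⟨a, ha.le⟩ ⟨b, hb.le⟩
  have hbdd : BddBelow {y : ℝ | v ≤ distFun P Y y} :=
    ⟨a, fun z hz => (hmono.reflect_lt (ha.trans_le hz)).le⟩
  have hclosed : IsClosed {y : ℝ | v ≤ distFun P Y y} := isClosed_le continuous_const hF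
  refine le_antisymm ?_ (hclosed.csInf_mem ⟨y, hy.ge⟩ hbdd)
  exact (hmono (csInf_le hbdd hy.ge)).trans hy.le

/-- Continuity rules out an atom at the quantile, so the left limit of the distribution function
there is still `v`. -/
theorem measureReal_quantile_le {Ω : Type*} [MeasurableSpace Ω] (P : Measure Ω)
    [IsProbabilityMeasure P] {Y : Ω → ℝ} (hY : Measurable Y) (hF : Continuous (distFun P Y))
    {v : ℝ} (hv : v ∈ Ioo (0 : ℝ) 1) : P.real {ω | quantile P Y v ≤ Y ω} = 1 - v := by
  have := Measure.isProbabilityMeasure_map (μ := P) hY.aemeasurable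
  have hcdf := distFun_eq_cdf P hY
  have hq := distFun_quantile P hY hF hv
  have hleft : Function.leftLim (cdf (P.map Y)) (quantile P Y v) = v := by
    rw [← hcdf, hF.continuousAt.continuousWithinAt.leftLim_eq, hq]
  change P.real (Y ⁻¹' Ici (quantile P Y v)) = _
  rw [← map_measureReal_apply hY measurableSet_Ici, measureReal_def]
  nth_rewrite 1 [← measure_cdf (P.map Y)]
  rw [StieltjesFunction.measure_Ici _ (tendsto_cdf_atTop _), hleft,
    ENNReal.toReal_ofReal (by linarith [hv.2])]

theorem aestronglyMeasurable_condSurvival {Ω : Type*} [MeasurableSpace Ω] (P : Measure Ω) {p : ℕ}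
    {X : Ω → Fin p → ℝ} {Y : Ω → ℝ} (y : ℝ) : AEStronglyMeasurable (condSurvival P Y X y) P :=
  integrable_condExp.aestronglyMeasurable

section condSurvival

variable {Ω : Type*} [MeasurableSpace Ω] (P : Measure Ω) [IsProbabilityMeasure P] {p : ℕ}
  {X : Ω → Fin p → ℝ} {Y : Ω → ℝ}

theorem integral_condSurvival (hX : Measurable X) (hY : Measurable Y) (y : ℝ) :
    ∫ ω, condSurvival P Y X y ω ∂P = P.real {ω | y ≤ Y ω} := by
  rw [condSurvival, integral_condExp hX.comap_le,
    integral_indicator_const _ (measurableSet_le measurable_const hY)]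
  simp

theorem condSurvival_mem_Icc (hX : Measurable X) (hY : Measurable Y) (y : ℝ) :
    ∀ᵐ ω ∂P, condSurvival P Y X y ω ∈ Icc (0 : ℝ) 1 := by
  have hA : MeasurableSet {ω | y ≤ Y ω} := measurableSet_le measurable_const hY
  have hle := condExp_mono (μ := P)
    (m := MeasurableSpace.comap X (inferInstance : MeasurableSpace (Fin p → ℝ)))
    ((integrable_const (1 : ℝ)).indicator hA) (integrable_const (1 : ℝ))
    (ae_of_all P fun ω => indicator_le_self' (fun _ _ => zero_le_one) ω)
  rw [condExp_const hX.comap_le] at hle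
  have hge := condExp_nonneg (μ := P)
    (m := MeasurableSpace.comap X (inferInstance : MeasurableSpace (Fin p → ℝ)))
    (ae_of_all P fun ω =>
      (indicator_nonneg (s := {ω | y ≤ Y ω}) (f := fun _ => (1 : ℝ))
        (fun _ _ => zero_le_one) ω))
  filter_upwards [hle, hge] with ω h1 h2
  exact ⟨h2, h1⟩

/-- The event already belongs to the σ-algebra of `X`, so conditioning leaves its indicator
unchanged, everywhere and not just almost surely. -/
theorem condSurvival_of_measurable_comp (hX : Measurable X) {f : (Fin p → ℝ) → ℝ}
    (hf : Measurable f) (y : ℝ) :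
    condSurvival P (fun ω => f (X ω)) X y = {ω | y ≤ f (X ω)}.indicator fun _ => (1 : ℝ) := by
  have hA : MeasurableSet[MeasurableSpace.comap X inferInstance] {ω | y ≤ f (X ω)} :=
    ⟨{x | y ≤ f x}, measurableSet_le measurable_const hf, rfl⟩
  exact condExp_of_stronglyMeasurable hX.comap_le (stronglyMeasurable_const.indicator hA)
    ((integrable_const 1).indicator (hX.comap_le _ hA))

/-- For noise independent of the regressors, the conditional survival probability in the additive
model is the survival function of the noise, evaluated at the standardised level. -/
theorem condSurvival_add_mul (hX : Measurable X) {ε : Ω → ℝ} (hε : Measurable ε)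
    {f : (Fin p → ℝ) → ℝ} (hf : Measurable f) {σ : ℝ} (hσ : 0 < σ) (hind : IndepFun ε X P)
    (y : ℝ) :
    condSurvival P (fun ω => f (X ω) + σ * ε ω) X y =ᵐ[P]
      fun ω => (P.map ε).real (Ici ((y - f (X ω)) / σ)) := by
  have := Measure.isProbabilityMeasure_map (μ := P) hε.aemeasurable
  have hB : MeasurableSet {z : (Fin p → ℝ) × ℝ | y ≤ f z.1 + σ * z.2} :=
    measurableSet_le measurable_const (by fun_prop)
  -- Independence: the conditional law of `ε` given `X` is its unconditional law.
  have hcond : condDistrib ε X P =ᵐ[P.map X] Kernel.const _ (P.map ε) := by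
    refine condDistrib_ae_eq_of_measure_eq_compProd X hε.aemeasurable ?_
    rw [Measure.compProd_const]
    exact (indepFun_iff_map_prod_eq_prod_map_map hX.aemeasurable hε.aemeasurable).1 hind.symm
  have h := condExp_prod_ae_eq_integral_condDistrib (μ := P) (Y := ε)
    (f := {z : (Fin p → ℝ) × ℝ | y ≤ f z.1 + σ * z.2}.indicator fun _ => (1 : ℝ)) hX hε.aemeasurable
    (stronglyMeasurable_const.indicator hB)
    ((integrable_const (1 : ℝ)).indicator ((hX.prodMk hε) hB))
  refine EventuallyEq.trans h ?_
  filter_upwards [ae_of_ae_map hX.aemeasurable hcond] with ω hω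
  rw [hω, Kernel.const_apply]
  have hset : (fun t : ℝ => {z : (Fin p → ℝ) × ℝ | y ≤ f z.1 + σ * z.2}.indicator
      (fun _ => (1 : ℝ)) (X ω, t)) = (Ici ((y - f (X ω)) / σ)).indicator fun _ => (1 : ℝ) := by
    ext t
    have : y ≤ f (X ω) + σ * t ↔ (y - f (X ω)) / σ ≤ t := by
      rw [div_le_iff₀ hσ, sub_le_iff_le_add', mul_comm]
    simp only [indicator, mem_ofPred_eq, mem_Ici, this]
  rw [hset, integral_indicator_const _ measurableSet_Ici]
  simp

end condSurvival

/-- Two affine functions of `u` with slopes `-1/σ' > -1/σ` cross exactly once. -/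
theorem exists_crossing_standardised_level {σ σ' : ℝ} (hσ : 0 < σ) (hσσ' : σ < σ') (q q' : ℝ) :
    ∃ t : ℝ, ∀ u : ℝ, ((q - u) / σ ≤ (q' - u) / σ' ∧ (q' - u) / σ' ≤ t) ∨
      (t ≤ (q' - u) / σ' ∧ (q' - u) / σ' ≤ (q - u) / σ) := by
  have hσ' := hσ.trans hσσ'
  have hd : 0 < σ' - σ := sub_pos.2 hσσ'
  -- At the crossing, `q - u = σ t` and `q' - u = σ' t`; subtracting gives `t`.
  refine ⟨(q' - q) / (σ' - σ), fun u => ?_⟩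
  rcases le_total ((q - u) * σ') ((q' - u) * σ) with h | h
  · left
    rw [div_le_div_iff₀ hσ hσ', div_le_div_iff₀ hσ' hd]
    exact ⟨h, by nlinarith⟩
  · right
    rw [div_le_div_iff₀ hσ' hσ, div_le_div_iff₀ hd hσ']
    exact ⟨by nlinarith, h⟩

theorem theorem3 {Ω : Type*} [MeasurableSpace Ω] (P : Measure Ω) [IsProbabilityMeasure P]
    {p : ℕ} (X : Ω → Fin p → ℝ) (hX : Measurable X)
    (ε : Ω → ℝ) (hε : Measurable ε)
    (f : (Fin p → ℝ) → ℝ) (hf : Measurable f)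
    (σ σ' : ℝ) (hσ : 0 ≤ σ) (hσσ' : σ < σ')
    (hind : IndepFun ε (fun ω => f (X ω)) P)
    (hindX : 0 < σ → IndepFun ε X P)
    (Y Y' : Ω → ℝ)
    (hY : ∀ ω, Y ω = f (X ω) + σ * ε ω)
    (hY' : ∀ ω, Y' ω = f (X ω) + σ' * ε ω)
    (hFY : Continuous (distFun P Y)) (hFY' : Continuous (distFun P Y')) :
    CondConvexLE P Y' X P Y X := by
  obtain rfl : Y = fun ω => f (X ω) + σ * ε ω := funext hY
  obtain rfl : Y' = fun ω => f (X ω) + σ' * ε ω := funext hY'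
  have hYm : Measurable fun ω => f (X ω) + σ * ε ω := by fun_prop
  have hYm' : Measurable fun ω => f (X ω) + σ' * ε ω := by fun_prop
  intro v hv
  have hmean := measureReal_quantile_le P hYm hFY hv
  have hmean' := measureReal_quantile_le P hYm' hFY' hv
  set q := quantile P (fun ω => f (X ω) + σ * ε ω) v
  set q' := quantile P (fun ω => f (X ω) + σ' * ε ω) v
  rcases hσ.eq_or_lt with rfl | hσ
  · simp only [zero_mul, add_zero] at hYm hmean ⊢
    rw [condSurvival_of_measurable_comp P hX hf]
    refine convexOrderLE_indicator (aestronglyMeasurable_condSurvival P _)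
      (measurableSet_le measurable_const hYm) (condSurvival_mem_Icc P hX hYm' _) ?_
    rw [integral_condSurvival P hX hYm', hmean', hmean]
  · obtain ⟨t, ht⟩ := exists_crossing_standardised_level hσ hσσ' q q'
    have := Measure.isProbabilityMeasure_map (μ := P) hε.aemeasurable
    have hanti : ∀ {a b : ℝ}, a ≤ b → (P.map ε).real (Ici b) ≤ (P.map ε).real (Ici a) :=
      fun h => measureReal_mono (Ici_subset_Ici.2 h)
    refine convexOrderLE_of_crossing (c := (P.map ε).real (Ici t))
      (aestronglyMeasurable_condSurvival P _) (aestronglyMeasurable_condSurvival P _)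
      (condSurvival_mem_Icc P hX hYm' _) (condSurvival_mem_Icc P hX hYm _) ?_ ?_
    · rw [integral_condSurvival P hX hYm', integral_condSurvival P hX hYm, hmean', hmean]
    · filter_upwards [condSurvival_add_mul P hX hε hf hσ (hindX hσ) q,
        condSurvival_add_mul P hX hε hf (hσ.trans hσσ') (hindX hσ) q'] with ω h h'
      rw [h, h']
      -- The survival function of `ε` is decreasing, so it reverses both inequalities of each
      -- alternative.
      exact (ht (f (X ω))).imp (fun H => ⟨hanti H.2, hanti H.1⟩) (fun H => ⟨hanti H.2, hanti H.1⟩)
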